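/- Let $\mathfrak{H}$ be a non-empty class of infinite regular cardinals. A linearly ordered topological space (LOTS) is a linearly ordered set with the topology generated by its open rays. A space is $\mathfrak{H}$-compact if, for every $\kappa\in\mathfrak{H}$, it is $[\kappa,\kappa]$-compact, i.e. every open covering of cardinality $\le\kappa$ has a sub-covering of cardinality $<\kappa$. A gap of a LOTS $X$ is an ordered pair $(A,B)$ of (possibly empty) open subsets of $X$ such that $X=A\cup B$, $a<b$ for all $a\in A$ and $b\in B$, $A$ has no maximum and $B$ has no minimum; a cardinal $\kappa$ is a type of the gap if $\kappa$ is the cofinality of $A$ or the coinitiality of $B$. Let $\mathbf{P}(\mathfrak{H})$ be the statement: for every LOTS $X$, $X$ is $\mathfrak{H}$-compact if and only if $X$ has no gap with a type in $\mathfrak{H}$. Theorem. $\mathbf{P}(\mathfrak{H})$ holds if and only if $\inf\mathfrak{H}$ is $\omega$ or a weakly compact cardinal, where a cardinal $\kappa$ is weakly compact if it is uncountable and $\kappa\to(\kappa)^2_2$, i.e. for every colouring of the two-element subsets of a set of cardinality $\kappa$ with two colours there is a homogeneous subset of cardinality $\kappa$. -/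

import Mathlib

open Cardinal

universe u

/-- `X` is `[κ, ν]`-compact: every open covering of cardinality `≤ ν` has a sub-covering of
cardinality `< κ`. -/
def IsCardinalCompact (κ ν : Cardinal.{u}) (X : Type u) [TopologicalSpace X] : Prop :=
  ∀ U : Set (Set X), (∀ O ∈ U, IsOpen O) → ⋃₀ U = Set.univ → #U ≤ ν →
    ∃ V : Set (Set X), V ⊆ U ∧ ⋃₀ V = Set.univ ∧ #V < κ

/-- `X` is `𝔥`-compact: it is `[κ, κ]`-compact for every `κ ∈ 𝔥`. -/
def IsClassCompact (𝔥 : Set Cardinal.{u}) (X : Type u) [TopologicalSpace X] : Prop :=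
  ∀ κ ∈ 𝔥, IsCardinalCompact κ κ X

/-- The ordered pair `(A, B)` is a gap of `X`. One of the two sides may be empty. -/
structure IsGap {X : Type u} [LinearOrder X] [TopologicalSpace X] (A B : Set X) : Prop where
  isOpen_left : IsOpen A
  isOpen_right : IsOpen B
  union_eq : A ∪ B = Set.univ
  lt : ∀ a ∈ A, ∀ b ∈ B, a < b
  no_max : ¬ ∃ a, IsGreatest A a
  no_min : ¬ ∃ b, IsLeast B b

/-- `X` has a gap `(A, B)` of type `κ`: `κ` is the cofinality of `A` or the coinitiality of `B`. -/
def HasGapOfType (κ : Cardinal.{u}) (X : Type u) [LinearOrder X] [TopologicalSpace X] : Prop :=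
  ∃ A B : Set X, IsGap A B ∧ (Order.cof ↥A = κ ∨ Order.cof (↥B)ᵒᵈ = κ)

/-- The statement `P(𝔥)`: a linearly ordered topological space is `𝔥`-compact if and only if it
has no gap whose type is in `𝔥`. -/
def PropertyP (𝔥 : Set Cardinal.{u}) : Prop :=
  ∀ (X : Type u) [LinearOrder X] [TopologicalSpace X] [OrderTopology X],
    IsClassCompact 𝔥 X ↔ ¬ ∃ κ ∈ 𝔥, HasGapOfType κ X

/-- `κ` is weakly compact: it is uncountable and `κ → (κ)²₂`, that is, every colouring of the
unordered pairs of distinct elements of a set of size `κ` with two colours has a homogeneous set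
of size `κ`. The colouring is written on `Sym2 α`; its values on the diagonal play no role. -/
def IsWeaklyCompact (κ : Cardinal.{u}) : Prop :=
  ℵ₀ < κ ∧ ∀ α : Type u, #α = κ → ∀ c : Sym2 α → Bool,
    ∃ S : Set α, #S = κ ∧ ∃ i : Bool, ∀ x ∈ S, ∀ y ∈ S, x ≠ y → c s(x, y) = i

/-! Let λ = inf 𝔥. A gap of type κ always refutes [κ,κ]-compactness, so only the other implication
constrains 𝔥.

If P(𝔥) holds and λ > ω, take a colouring of pairs from a well-order W of type λ. Its rows, ordered
lexicographically and multiplied by ℤ, form a discrete LOTS of size λ, which is not [λ,λ]-compact.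
So some gap has a type κ ≥ λ. Along that side of the gap the rows are monotone, and each coordinate
is eventually constant. A maximal set on which colours agree with these limit values has size λ, and
half of it is homogeneous.

Conversely, failure of [κ,κ]-compactness yields a set Y of size κ that is locally smaller than κ.
Identify points with fewer than κ points of Y between them. A class containing κ points of Y gives a
gap of type κ. Otherwise there are at least κ classes, and the partition property of λ extracts from
them a sequence of length λ, increasing or decreasing, which converges nowhere: a gap of type λ. -/

/-! ### Stabilisation of lexicographically monotone families -/

section EventuallyConstant

variable {I : Type u} [LinearOrder I]

theorem exists_forall_ge_forall_of_mk_lt_cof {J : Type u} (hJ : #J < Order.cof I)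
    {P : J → I → Prop} (h : ∀ j, ∃ i₀, ∀ i ≥ i₀, P j i) : ∃ i₀, ∀ i ≥ i₀, ∀ j, P j i := by
  choose f hf using h
  have h1 : ¬ IsCofinal (Set.range f) := fun hc =>
    (Order.cof_le hc).not_gt (mk_range_le.trans_lt hJ)
  obtain ⟨x, hx⟩ := not_isCofinal_iff.1 h1
  exact ⟨x, fun i hi j => hf j i ((hx _ ⟨j, rfl⟩).le.trans hi)⟩

theorem eventually_eq_of_monotone_from {α : Type*} [LinearOrder α] [Finite α] {g : I → α} {i₀ : I}
    (hg : ∀ i j, i₀ ≤ i → i ≤ j → g i ≤ g j) : ∃ v, ∃ i₁, ∀ i ≥ i₁, g i = v := by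
  obtain ⟨v, ⟨i₁, hi₁, rfl⟩, hmax⟩ :=
    wellFounded_gt.has_min (g '' Set.Ici i₀) ⟨_, i₀, le_rfl, rfl⟩
  refine ⟨_, i₁, fun i hi => le_antisymm (not_lt.1 (hmax _ ⟨i, le_trans hi₁ hi, rfl⟩)) ?_⟩
  exact hg _ _ hi₁ hi

/-- Induction on `w`: the fewer than cofinality many earlier coordinates are constant past a common
index, and from there the lexicographic order compares coordinate `w`, which is then monotone in a
finite chain. -/
theorem eventually_eq_coord_of_monotone_lex [Nonempty I] {W : Type u} [LinearOrder W]
    [WellFoundedLT W] {α : Type*} [LinearOrder α] [Finite α] {f : I → W → α}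
    (hf : Monotone (fun i => toLex (f i)) ∨ Antitone (fun i => toLex (f i)))
    (hW : ∀ w : W, #(Set.Iio w) < Order.cof I) (w : W) : ∃ v, ∃ i₁, ∀ i ≥ i₁, f i w = v := by
  induction w using WellFoundedLT.induction with
  | ind w ih =>
    have h : ∀ j : Set.Iio w, ∃ i₀, ∀ i ≥ i₀, ∀ k ≥ i₀, f i j = f k j := by
      rintro ⟨j, hj⟩
      obtain ⟨v, i₁, h⟩ := ih j hj
      exact ⟨i₁, fun i hi k hk => (h i hi).trans (h k hk).symm⟩
    choose i₁ hi₁ using h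
    obtain ⟨i₀, hi₀⟩ := exists_forall_ge_forall_of_mk_lt_cof (hW w)
      (P := fun j i => i₁ j ≤ i) (fun j => ⟨i₁ j, fun i hi => hi⟩)
    have agree : ∀ i k, i₀ ≤ i → i ≤ k → ∀ j < w, f i j = f k j := fun i k hi hk j hj =>
      hi₁ ⟨j, hj⟩ i (hi₀ i hi _) k (hi₀ k (hi.trans hk) _)
    rcases hf with hf | hf
    · exact eventually_eq_of_monotone_from (i₀ := i₀) fun i k hi hk =>
        Pi.apply_le_of_toLex (hf hk) (agree i k hi hk)
    · obtain ⟨v, h⟩ := eventually_eq_of_monotone_from (i₀ := i₀)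
        (g := fun i => OrderDual.toDual (f i w)) fun i k hi hk =>
        OrderDual.toDual_le_toDual.2
          (Pi.apply_le_of_toLex (hf hk) fun j hj => (agree i k hi hk j hj).symm)
      exact ⟨OrderDual.ofDual v, h⟩

end EventuallyConstant

/-! ### From monotone rows to homogeneous sets -/

section Homogeneous

variable {W : Type u} [LinearOrder W]

/-- The colours of the pairs that contain `w`, with the extra value `none` at `w` itself. -/
def colorRow (c : Sym2 W → Bool) (w v : W) : WithTop Bool := if v = w then ⊤ else ↑(c s(v, w))

/-- The diagonal value occurs exactly once in each row, so it separates points that the colouring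
alone might not. -/
theorem colorRow_injective (c : Sym2 W → Bool) : Function.Injective (colorRow c) := by
  intro a b h
  have := congrFun h a
  by_contra hab
  simp [colorRow, hab] at this

/-- A set in which the colour of a pair is determined by the smaller element. -/
def IsEndHomogeneous (c : Sym2 W → Bool) (b : W → Bool) (S : Set W) : Prop :=
  ∀ x ∈ S, ∀ y ∈ S, x < y → c s(x, y) = b x

theorem IsEndHomogeneous.exists_homogeneous {c : Sym2 W → Bool} {b : W → Bool} {S : Set W}
    (hS : IsEndHomogeneous c b S) (hinf : ℵ₀ ≤ #S) :
    ∃ T : Set W, #T = #S ∧ ∃ i : Bool, ∀ x ∈ T, ∀ y ∈ T, x ≠ y → c s(x, y) = i := by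
  have key : ∀ i : Bool, ∀ x ∈ {x ∈ S | b x = i}, ∀ y ∈ {x ∈ S | b x = i}, x ≠ y →
      c s(x, y) = i := by
    rintro i x ⟨hx, hxi⟩ y ⟨hy, hyi⟩ hne
    rcases lt_or_gt_of_ne hne with h | h
    · rw [hS x hx y hy h, hxi]
    · rw [Sym2.eq_swap, hS y hy x hx h, hyi]
  have hu : S = {x ∈ S | b x = true} ∪ {x ∈ S | b x = false} := by
    ext x; cases h : b x <;> simp [h]
  have hle : ∀ i, #{x ∈ S | b x = i} ≤ #S := fun i => mk_le_mk_of_subset (Set.sep_subset _ _)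
  by_contra hcon
  push Not at hcon
  have hlt : ∀ i, #{x ∈ S | b x = i} < #S := fun i => by
    refine (hle i).lt_of_ne fun h => ?_
    obtain ⟨x, hx, y, hy, hne, h'⟩ := hcon _ h i
    exact h' (key i x hx y hy hne)
  have := (mk_union_le {x ∈ S | b x = true} {x ∈ S | b x = false}).trans_lt
    (add_lt_of_lt hinf (hlt true) (hlt false))
  rw [← hu] at this
  exact this.false

theorem exists_homogeneous_of_monotone_colorRow [WellFoundedLT W] {lam : Cardinal.{u}}
    (hlam : lam.IsRegular) (hW : #W = lam) (hIio : ∀ w : W, #(Set.Iio w) < lam)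
    (c : Sym2 W → Bool) {I : Type u} [LinearOrder I] (hI : lam ≤ Order.cof I) (x : I → W)
    (hx : ∀ w, #(x ⁻¹' {w}) < lam)
    (hmono : Monotone (fun i => toLex (colorRow c (x i))) ∨
      Antitone (fun i => toLex (colorRow c (x i)))) :
    ∃ T : Set W, #T = lam ∧ ∃ i : Bool, ∀ x ∈ T, ∀ y ∈ T, x ≠ y → c s(x, y) = i := by
  have hne : Nonempty I := Order.cof_ne_zero_iff.1 (hlam.pos.trans_le hI).ne'
  have hev : ∀ w, ∃ i₀, ∀ i ≥ i₀, x i ≠ w := fun w => by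
    have h1 : ¬ IsCofinal (x ⁻¹' {w}) := fun hc =>
      ((Order.cof_le hc).trans_lt (hx w)).not_ge hI
    obtain ⟨i₀, hi₀⟩ := not_isCofinal_iff.1 h1
    exact ⟨i₀, fun i hi h => (hi₀ i h).not_ge hi⟩
  have hrow : ∀ w, ∃ v : Bool, ∃ i₀, ∀ i ≥ i₀, x i ≠ w → c s(w, x i) = v := fun w => by
    obtain ⟨v, i₀, h⟩ := eventually_eq_coord_of_monotone_lex hmono
      (fun w => (hIio w).trans_le hI) w
    -- The default is harmless: if `v = ⊤`, then `x i = w` for all `i ≥ i₀`.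
    refine ⟨v.untopD true, i₀, fun i hi hne => ?_⟩
    rw [← h i hi, colorRow, if_neg hne.symm, WithTop.untopD_coe]
  choose b hb using hrow
  obtain ⟨S, hS⟩ : ∃ S, Maximal (IsEndHomogeneous c b) S := by
    refine zorn_subset _ fun C hC hchain => ⟨⋃₀ C, ?_, fun s hs => Set.subset_sUnion_of_mem hs⟩
    rintro y ⟨s, hs, hys⟩ z ⟨t, ht, hzt⟩ hyz
    rcases hchain.total hs ht with h | h
    · exact hC ht y (h hys) z hzt hyz
    · exact hC hs y hys z (h hzt) hyz
  have hSl : #S = lam := by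
    refine ((mk_set_le S).trans_eq hW).eq_of_not_lt fun hlt => ?_
    -- If `S` were small, so would be its downward closure; a late `x i` avoids that closure and has
    -- the limit colour with every point of `S`, so it extends `S`.
    have hD : #(⋃ s : S, Set.Iic (s : W)) < lam := by
      rw [card_iUnion_lt_iff_forall_of_isRegular hlam hlt]
      intro s
      rw [← Set.Iio_insert]
      exact (mk_insert_le).trans_lt
        (add_lt_of_lt hlam.aleph0_le (hIio _) (one_lt_aleph0.trans_le hlam.aleph0_le))
    obtain ⟨i₁, hi₁⟩ := exists_forall_ge_forall_of_mk_lt_cof (hD.trans_le hI)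
      (P := fun w i => x i ≠ w) (fun w => hev w)
    obtain ⟨i₂, hi₂⟩ := exists_forall_ge_forall_of_mk_lt_cof (hlt.trans_le hI)
      (P := fun w i => x i ≠ w → c s(↑w, x i) = b w) (fun w => hb w)
    set i := max i₁ i₂
    have hgt : ∀ s ∈ S, s < x i := fun s hs => by
      by_contra hcon
      exact hi₁ i (le_max_left _ _) ⟨x i, Set.mem_iUnion.2 ⟨⟨s, hs⟩, not_lt.1 hcon⟩⟩ rfl
    have hins : IsEndHomogeneous c b (insert (x i) S) := by
      rintro y (rfl | hy) z (rfl | hz) hyz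
      · exact (lt_irrefl _ hyz).elim
      · exact ((hgt z hz).not_gt hyz).elim
      · exact hi₂ i (le_max_right _ _) ⟨y, hy⟩ hyz.ne'
      · exact hS.prop y hy z hz hyz
    exact (hgt _ (hS.le_of_ge hins (Set.subset_insert _ _) (Set.mem_insert _ _))).false
  obtain ⟨T, hT, h⟩ := hS.prop.exists_homogeneous (hSl ▸ hlam.aleph0_le)
  exact ⟨T, hT.trans hSl, h⟩

end Homogeneous

/-! ### The discrete ordered space of a colouring -/

section LexInt

theorem discreteTopology_lex_prod_int (L : Type u) [LinearOrder L]
    [TopologicalSpace (L ×ₗ ℤ)] [OrderTopology (L ×ₗ ℤ)] : DiscreteTopology (L ×ₗ ℤ) := by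
  refine discreteTopology_iff_isOpen_singleton.2 fun p => ?_
  have : ({p} : Set (L ×ₗ ℤ)) =
      Set.Ioo (toLex ((ofLex p).1, (ofLex p).2 - 1)) (toLex ((ofLex p).1, (ofLex p).2 + 1)) := by
    ext q
    simp only [Set.mem_singleton_iff, Set.mem_Ioo, Prod.Lex.lt_iff, ofLex_toLex]
    constructor
    · rintro rfl
      exact ⟨Or.inr ⟨rfl, by omega⟩, Or.inr ⟨rfl, by omega⟩⟩
    · rintro ⟨h1 | h1, h2 | h2⟩
      · exact (h1.not_gt h2).elim
      · exact (h1.ne' h2.1).elim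
      · exact (h2.ne h1.1.symm).elim
      · exact ofLex.injective (Prod.ext h2.1 (by omega))
  rw [this]
  exact isOpen_Ioo

theorem not_isCardinalCompact_of_discreteTopology (X : Type u) [TopologicalSpace X]
    [DiscreteTopology X] : ¬ IsCardinalCompact #X #X X := by
  intro h
  obtain ⟨V, hVU, hV, hlt⟩ := h (Set.range fun x : X => {x}) (fun _ _ => isOpen_discrete _)
    (Set.eq_univ_of_forall fun x => ⟨{x}, ⟨x, rfl⟩, rfl⟩) mk_range_le
  have hmem : ∀ x : X, ({x} : Set X) ∈ V := fun x => by
    obtain ⟨s, hs, hx⟩ := Set.eq_univ_iff_forall.1 hV x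
    obtain ⟨y, rfl⟩ := hVU hs
    obtain rfl : x = y := hx
    exact hs
  refine hlt.not_ge (mk_le_of_injective (f := fun x : X => (⟨{x}, hmem x⟩ : V)) fun x y hxy => ?_)
  exact Set.singleton_injective (congrArg Subtype.val hxy)

theorem exists_homogeneous_of_propertyP {𝔥 : Set Cardinal.{u}} (hP : PropertyP 𝔥)
    {lam : Cardinal.{u}} (hmem : lam ∈ 𝔥) (hmin : ∀ κ ∈ 𝔥, lam ≤ κ) (hlam : lam.IsRegular)
    (hunc : ℵ₀ < lam) {W : Type u} [LinearOrder W] [WellFoundedLT W] (hW : #W = lam)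
    (hIio : ∀ w : W, #(Set.Iio w) < lam) (c : Sym2 W → Bool) :
    ∃ T : Set W, #T = lam ∧ ∃ i : Bool, ∀ x ∈ T, ∀ y ∈ T, x ≠ y → c s(x, y) = i := by
  set F : W → Lex (W → WithTop Bool) := fun w => toLex (colorRow c w) with hF
  have hFinj : Function.Injective F := fun a b h => colorRow_injective c h
  let e : W ≃ Set.range F := Equiv.ofInjective F hFinj
  have hFe : ∀ l, F (e.symm l) = l := fun l => Equiv.apply_ofInjective_symm hFinj l
  let _ : TopologicalSpace (Set.range F ×ₗ ℤ) := Preorder.topology _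
  have : OrderTopology (Set.range F ×ₗ ℤ) := ⟨rfl⟩
  have := discreteTopology_lex_prod_int (Set.range F)
  let x : Set.range F ×ₗ ℤ → W := fun p => e.symm (ofLex p).1
  have hxmono : Monotone fun p => F (x p) := fun p q hpq => by
    simp only [x, hFe]
    exact Prod.Lex.monotone_fst _ _ hpq
  -- Fibres are copies of ℤ; uncountability of `lam` makes them small.
  have hfib : ∀ w, #(x ⁻¹' {w}) < lam := fun w => by
    have hinj : Function.Injective fun p : x ⁻¹' {w} => (ofLex p.1).2 := by
      rintro ⟨p, hp⟩ ⟨q, hq⟩ h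
      refine Subtype.ext (ofLex.injective (Prod.ext (e.symm.injective ?_) h))
      exact Eq.trans hp (Eq.symm hq)
    exact (mk_le_aleph0_iff.2 hinj.countable).trans_lt hunc
  have hfib' : ∀ (A : Set (Set.range F ×ₗ ℤ)) (w : W), #((fun a : A => x a) ⁻¹' {w}) < lam :=
    fun A w => (mk_preimage_of_injective Subtype.val (x ⁻¹' {w})
      Subtype.val_injective).trans_lt (hfib w)
  have hcard : #(Set.range F ×ₗ ℤ) = lam := by
    have h1 : #(Set.range F ×ₗ ℤ) = #(Set.range F × ℤ) := rfl
    rw [h1, mk_prod, mk_range_eq F hFinj, hW, lift_uzero, mk_int, lift_aleph0]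
    exact mul_eq_left hlam.aleph0_le hlam.aleph0_le aleph0_ne_zero
  have hnc : ¬ IsClassCompact 𝔥 (Set.range F ×ₗ ℤ) := fun h =>
    not_isCardinalCompact_of_discreteTopology _ (hcard ▸ h lam hmem)
  rw [hP, not_not] at hnc
  obtain ⟨κ, hκ, A, B, -, hA | hB⟩ := hnc
  · exact exists_homogeneous_of_monotone_colorRow hlam hW hIio c ((hmin κ hκ).trans hA.ge)
      (fun a => x a) (hfib' A) (Or.inl fun a b hab => hxmono hab)
  · exact exists_homogeneous_of_monotone_colorRow hlam hW hIio c (I := (↥B)ᵒᵈ)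
      ((hmin κ hκ).trans hB.ge) (fun a => x (OrderDual.ofDual a).1) (hfib' B)
      (Or.inr fun a b hab => hxmono hab)

theorem isWeaklyCompact_of_propertyP {𝔥 : Set Cardinal.{u}} (hP : PropertyP 𝔥)
    {lam : Cardinal.{u}} (hmem : lam ∈ 𝔥) (hmin : ∀ κ ∈ 𝔥, lam ≤ κ) (hlam : lam.IsRegular)
    (hunc : ℵ₀ < lam) : IsWeaklyCompact lam := by
  refine ⟨hunc, fun α hα c => ?_⟩
  obtain ⟨e⟩ : Nonempty (lam.ord.ToType ≃ α) := Cardinal.eq.1 (by rw [mk_ord_toType, hα])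
  obtain ⟨T, hT, i, h⟩ := exists_homogeneous_of_propertyP hP hmem hmin hlam hunc
    (mk_ord_toType lam) (fun w => by simpa using mk_Iio_lt w (by simp)) (fun p => c (p.map e))
  refine ⟨e '' T, (mk_image_eq e.injective).trans hT, i, ?_⟩
  rintro _ ⟨x, hx, rfl⟩ _ ⟨y, hy, rfl⟩ hne
  exact h x hx y hy fun hxy => hne (congrArg e hxy)

end LexInt

/-! ### Gaps and their types -/

section Gaps

variable {X : Type u} [LinearOrder X] [TopologicalSpace X]

theorem IsGap.dual {A B : Set X} (h : IsGap A B) :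
    IsGap (X := Xᵒᵈ) (OrderDual.ofDual ⁻¹' B) (OrderDual.ofDual ⁻¹' A) where
  isOpen_left := h.isOpen_right
  isOpen_right := h.isOpen_left
  union_eq := (Set.union_comm B A).trans h.union_eq
  lt := fun _ ha _ hb => h.lt _ hb _ ha
  no_max := h.no_min
  no_min := h.no_max

theorem HasGapOfType.dual {κ : Cardinal.{u}} (h : HasGapOfType κ X) : HasGapOfType κ Xᵒᵈ := by
  obtain ⟨A, B, hAB, h⟩ := h
  exact ⟨_, _, hAB.dual, h.symm⟩

theorem hasGapOfType_of_dual {κ : Cardinal.{u}} (h : HasGapOfType κ Xᵒᵈ) : HasGapOfType κ X :=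
  h.dual

/-- Cover by `B` and the rays below a cofinal subset of `A`: a smaller subcover would give a smaller
cofinal set. -/
theorem IsGap.not_isCardinalCompact_of_cof [OrderTopology X] {A B : Set X} (h : IsGap A B)
    {κ : Cardinal.{u}} (hκ : ℵ₀ ≤ κ) (hA : Order.cof A = κ) : ¬ IsCardinalCompact κ κ X := by
  intro hX
  obtain ⟨C, hC, hCκ⟩ := Order.exists_cof_eq (α := A)
  have hnext : ∀ a : A, ∃ c ∈ C, a < c := fun a => by
    by_contra hcon
    push Not at hcon
    refine h.no_max ⟨a, a.2, fun b hb => ?_⟩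
    obtain ⟨c, hc, hbc⟩ := hC ⟨b, hb⟩
    exact hbc.trans (hcon c hc)
  let J : A → Set X := fun c => Set.Iio (c : X)
  have hJ : Function.Injective J := fun a b hab => Subtype.ext (Set.Iio_injective hab)
  obtain ⟨V, hVU, hV, hlt⟩ := hX (insert B (J '' C))
    (by
      rintro O (rfl | ⟨c, -, rfl⟩)
      exacts [h.isOpen_right, isOpen_Iio])
    (by
      refine Set.eq_univ_of_forall fun x => ?_
      rcases h.union_eq.ge (Set.mem_univ x) with hx | hx
      · obtain ⟨c, hc, hxc⟩ := hnext ⟨x, hx⟩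
        exact ⟨_, Or.inr ⟨c, hc, rfl⟩, hxc⟩
      · exact ⟨B, Or.inl rfl, hx⟩)
    (mk_insert_le.trans (add_le_of_le hκ (mk_image_le.trans (hCκ.trans hA).le)
      (one_le_aleph0.trans hκ)))
  have hcof : IsCofinal (J ⁻¹' V) := fun a => by
    obtain ⟨O, hO, ha⟩ := Set.eq_univ_iff_forall.1 hV (a : X)
    rcases hVU hO with rfl | ⟨c, -, rfl⟩
    · exact (h.lt a a.2 a ha).false.elim
    · exact ⟨c, hO, le_of_lt ha⟩
  exact (((Order.cof_le hcof).trans (mk_preimage_of_injective J V hJ)).trans_lt hlt).ne hA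

theorem HasGapOfType.not_isCardinalCompact [OrderTopology X] {κ : Cardinal.{u}} (hκ : ℵ₀ ≤ κ)
    (h : HasGapOfType κ X) : ¬ IsCardinalCompact κ κ X := by
  obtain ⟨A, B, hAB, h | h⟩ := h
  · exact hAB.not_isCardinalCompact_of_cof hκ h
  · exact hAB.dual.not_isCardinalCompact_of_cof hκ h

/-- The gap sits just above `S`. A least upper point would have a neighbourhood containing a tail of
`S`, making both head and tail small. Regularity gives the cofinality. -/
theorem hasGapOfType_of_mk_initial_lt [OrderTopology X] {κ : Cardinal.{u}} (hκ : κ.IsRegular)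
    {S : Set X} (hS : #S = κ) (hseg : ∀ s ∈ S, #{t ∈ S | t ≤ s} < κ)
    (hloc : ∀ b : X, ∃ N ∈ nhds b, #(S ∩ N : Set X) < κ) : HasGapOfType κ X := by
  have hnext : ∀ s ∈ S, ∃ t ∈ S, s < t := fun s hs => by
    by_contra hcon
    push Not at hcon
    exact ((mk_le_mk_of_subset (show S ⊆ {t ∈ S | t ≤ s} from fun t ht => ⟨ht, hcon t ht⟩)).trans_lt
      (hseg s hs)).ne hS
  set A : Set X := {x | ∃ s ∈ S, x ≤ s} with hA
  have hSA : S ⊆ A := fun s hs => ⟨s, hs, le_rfl⟩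
  have hAB : ∀ a ∈ A, ∀ b ∈ Aᶜ, a < b := fun a ⟨s, hs, has⟩ b hb =>
    has.trans_lt (lt_of_not_ge fun h => hb ⟨s, hs, h⟩)
  have hmin : ¬ ∃ b, IsLeast Aᶜ b := by
    rintro ⟨b, hb, hbl⟩
    obtain ⟨N, hN, hNκ⟩ := hloc b
    obtain ⟨s₀, hs₀⟩ : S.Nonempty := by
      rw [← Set.nonempty_coe_sort, ← mk_ne_zero_iff, hS]
      exact hκ.ne_zero
    obtain ⟨l, hl, hlN⟩ := exists_Ioc_subset_of_mem_nhds hN ⟨s₀, hAB _ (hSA hs₀) b hb⟩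
    obtain ⟨s, hs, hls⟩ : l ∈ A := by
      by_contra hlA
      exact (hbl hlA).not_gt hl
    have hcov : S ⊆ {t ∈ S | t ≤ s} ∪ (S ∩ N) := fun t ht => by
      rcases le_or_gt t s with h | h
      · exact Or.inl ⟨ht, h⟩
      · exact Or.inr ⟨ht, hlN ⟨hls.trans_lt h, (hAB t (hSA ht) b hb).le⟩⟩
    exact (((mk_le_mk_of_subset hcov).trans (mk_union_le _ _)).trans_lt
      (add_lt_of_lt hκ.aleph0_le (hseg s hs) hNκ)).ne hS
  refine ⟨A, Aᶜ, ⟨?_, ?_, Set.union_compl_self A, hAB, ?_, hmin⟩, Or.inl (le_antisymm ?_ ?_)⟩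
  · refine isOpen_iff_mem_nhds.2 fun x ⟨s, hs, hxs⟩ => ?_
    obtain ⟨t, ht, hst⟩ := hnext s hs
    exact Filter.mem_of_superset (Iio_mem_nhds (hxs.trans_lt hst)) fun y hy => ⟨t, ht, le_of_lt hy⟩
  · refine isOpen_iff_mem_nhds.2 fun x hx => ?_
    obtain ⟨y, hy, hyx⟩ : ∃ y ∈ Aᶜ, y < x := by
      by_contra hcon
      push Not at hcon
      exact hmin ⟨x, hx, hcon⟩
    exact Filter.mem_of_superset (Ioi_mem_nhds hyx) fun z hz hzA => (hAB z hzA y hy).not_gt hz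
  · rintro ⟨a, ⟨s, hs, has⟩, hmax⟩
    obtain ⟨t, ht, hst⟩ := hnext s hs
    exact (has.trans_lt hst).not_ge (hmax (hSA ht))
  · have hcof : IsCofinal ((↑) ⁻¹' S : Set A) := fun ⟨a, s, hs, has⟩ =>
      ⟨⟨s, hSA hs⟩, hs, has⟩
    exact (Order.cof_le hcof).trans
      ((mk_preimage_of_injective _ S Subtype.val_injective).trans_eq hS)
  · refine Order.le_cof_iff.2 fun C hC => le_of_not_gt fun hlt => ?_
    have hcov : S ⊆ ⋃ c : C, {t ∈ S | t ≤ (c : A)} := fun t ht => by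
      obtain ⟨c, hc, htc⟩ := hC ⟨t, hSA ht⟩
      exact Set.mem_iUnion.2 ⟨⟨c, hc⟩, ht, htc⟩
    refine ((mk_le_mk_of_subset hcov).trans_lt
      ((card_iUnion_lt_iff_forall_of_isRegular hκ hlt).2 fun c => ?_)).ne hS
    obtain ⟨s, hs, hcs⟩ := c.1.2
    exact (mk_le_mk_of_subset (show _ ⊆ {t ∈ S | t ≤ s} from
      fun t ht => ⟨ht.1, ht.2.trans hcs⟩)).trans_lt (hseg s hs)

theorem hasGapOfType_of_mk_final_lt [OrderTopology X] {κ : Cardinal.{u}} (hκ : κ.IsRegular)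
    {S : Set X} (hS : #S = κ) (hseg : ∀ s ∈ S, #{t ∈ S | s ≤ t} < κ)
    (hloc : ∀ b : X, ∃ N ∈ nhds b, #(S ∩ N : Set X) < κ) : HasGapOfType κ X :=
  hasGapOfType_of_dual <| hasGapOfType_of_mk_initial_lt (X := Xᵒᵈ) hκ
    (S := OrderDual.ofDual ⁻¹' S) hS hseg hloc

end Gaps

/-! ### Monotone subsets from partition relations -/

section MonotoneSubsets

variable {X : Type u} [LinearOrder X]

/-- Sierpiński's colouring: a pair is coloured by whether the given order agrees with a well-order
of type `lam`. -/
theorem exists_monotone_subset_of_isWeaklyCompact {lam : Cardinal.{u}} (h : IsWeaklyCompact lam)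
    {R : Set X} (hR : #R = lam) : ∃ S ⊆ R, #S = lam ∧
      ((∀ s ∈ S, #{t ∈ S | t ≤ s} < lam) ∨ ∀ s ∈ S, #{t ∈ S | s ≤ t} < lam) := by
  classical
  obtain ⟨e⟩ : Nonempty (R ≃ lam.ord.ToType) := Cardinal.eq.1 (by rw [mk_ord_toType, hR])
  have hIic : ∀ w : lam.ord.ToType, #(Set.Iic w) < lam := fun w => by
    rw [← Set.Iio_insert]
    exact mk_insert_le.trans_lt (add_lt_of_lt h.1.le (by simpa using mk_Iio_lt w (by simp))
      (one_lt_aleph0.trans h.1))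
  have hsymm : ∀ x y : R, decide (x < y ↔ e x < e y) = decide (y < x ↔ e y < e x) := fun x y => by
    rcases lt_trichotomy x y with hxy | rfl | hxy
    · have : e x ≠ e y := fun h => hxy.ne (e.injective h)
      rcases lt_or_gt_of_ne this with h | h <;> simp [hxy, hxy.not_gt, h, h.not_gt]
    · rfl
    · have : e x ≠ e y := fun h => hxy.ne' (e.injective h)
      rcases lt_or_gt_of_ne this with h | h <;> simp [hxy, hxy.not_gt, h, h.not_gt]
  obtain ⟨T, hT, i, hi⟩ := h.2 R hR
    (Sym2.lift ⟨fun x y => decide (x < y ↔ e x < e y), hsymm⟩)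
  have hsub : ∀ (P : X → Prop) (w : lam.ord.ToType), (∀ t ∈ T, P t → e t ≤ w) →
      #{t ∈ ((↑) '' T : Set X) | P t} < lam := fun P w hP => by
    have : {t ∈ ((↑) '' T : Set X) | P t} ⊆ (fun w => (e.symm w : X)) '' Set.Iic w := by
      rintro _ ⟨⟨t, ht, rfl⟩, hPt⟩
      exact ⟨e t, hP t ht hPt, by simp⟩
    exact ((mk_le_mk_of_subset this).trans mk_image_le).trans_lt (hIic w)
  refine ⟨(↑) '' T, by rintro _ ⟨t, -, rfl⟩; exact t.2,
    (mk_image_eq Subtype.val_injective).trans hT, ?_⟩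
  cases i
  · right
    rintro _ ⟨s, hs, rfl⟩
    refine hsub _ (e s) fun t ht hst => ?_
    rcases eq_or_ne s t with rfl | hne
    · exact le_rfl
    · have := hi s hs t ht hne
      rw [Sym2.lift_mk] at this
      have hlt : s < t := lt_of_le_of_ne hst hne
      simpa [hlt] using this
  · left
    rintro _ ⟨s, hs, rfl⟩
    refine hsub _ (e s) fun t ht hts => ?_
    rcases eq_or_ne t s with rfl | hne
    · exact le_rfl
    · have := hi t ht s hs hne
      rw [Sym2.lift_mk] at this
      have hlt : t < s := lt_of_le_of_ne hts hne
      exact le_of_lt (by simpa [hlt] using this)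

theorem exists_monotone_subset_aleph0 {R : Set X} (hR : #R = ℵ₀) : ∃ S ⊆ R, #S = ℵ₀ ∧
    ((∀ s ∈ S, #{t ∈ S | t ≤ s} < ℵ₀) ∨ ∀ s ∈ S, #{t ∈ S | s ≤ t} < ℵ₀) := by
  have : Infinite R := infinite_iff.2 hR.ge
  let f : ℕ ↪ R := Infinite.natEmbedding R
  obtain ⟨g, hg⟩ := exists_increasing_or_nonincreasing_subseq (· < ·) f
  have hinj : Function.Injective fun n => (f (g n) : X) :=
    Subtype.val_injective.comp (f.injective.comp g.injective)
  refine ⟨Set.range fun n => (f (g n) : X), by rintro _ ⟨n, rfl⟩; exact (f (g n)).2, ?_, ?_⟩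
  · have := Set.infinite_range_of_injective hinj
    exact le_antisymm (mk_le_aleph0_iff.2 (Set.countable_range _).to_subtype)
      (infinite_iff.1 this.to_subtype)
  have hfin : ∀ (n : ℕ) (P : X → Prop), (∀ m, P (f (g m)) → m ≤ n) →
      #{t ∈ Set.range fun n => (f (g n) : X) | P t} < ℵ₀ := fun n P hP => by
    refine lt_aleph0_iff_set_finite.2 (((Set.finite_Iic n).image fun n => (f (g n) : X)).subset ?_)
    rintro _ ⟨⟨m, rfl⟩, hm⟩
    exact ⟨m, hP m hm, rfl⟩
  refine hg.imp (fun h => ?_) (fun h => ?_)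
  · rintro _ ⟨n, rfl⟩
    exact hfin n _ fun m hm => not_lt.1 fun hnm => (h n m hnm).not_ge hm
  · rintro _ ⟨n, rfl⟩
    refine hfin n _ fun m hm => not_lt.1 fun hnm => ?_
    exact h n m hnm (lt_of_le_of_ne hm fun heq => hnm.ne (f.injective.comp g.injective heq))

end MonotoneSubsets

/-! ### Locally small sets from bad covers -/

section NonCompact

variable {X : Type u} [TopologicalSpace X]

theorem exists_locally_small_of_not_isCardinalCompact {κ : Cardinal.{u}} (hκ : κ.IsRegular)
    (h : ¬ IsCardinalCompact κ κ X) :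
    ∃ Y : Set X, #Y = κ ∧ ∀ x, ∃ N ∈ nhds x, #(Y ∩ N : Set X) < κ := by
  unfold IsCardinalCompact at h
  push Not at h
  obtain ⟨U, hUo, hU, hUκ, hV⟩ := h
  have hUκ : #U = κ := le_antisymm hUκ (hV U subset_rfl hU)
  obtain ⟨e⟩ : Nonempty (κ.ord.ToType ≃ U) := Cardinal.eq.1 (by rw [mk_ord_toType, hUκ])
  have hIio : ∀ w : κ.ord.ToType, #(Set.Iio w) < κ := fun w => by simpa using mk_Iio_lt w (by simp)
  have hIic : ∀ w : κ.ord.ToType, #(Set.Iic w) < κ := fun w => by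
    rw [← Set.Iio_insert]
    exact mk_insert_le.trans_lt (add_lt_of_lt hκ.aleph0_le (hIio w)
      (one_lt_aleph0.trans_le hκ.aleph0_le))
  -- The cover members up to `w` are too few to cover `X`.
  have hx : ∀ w, ∃ x : X, ∀ v ≤ w, x ∉ (e v : Set X) := fun w => by
    by_contra hcon
    push Not at hcon
    refine (hV ((fun v => (e v : Set X)) '' Set.Iic w) ?_ ?_).not_gt
      (mk_image_le.trans_lt (hIic w))
    · rintro _ ⟨v, -, rfl⟩
      exact (e v).2
    · refine Set.eq_univ_of_forall fun x => ?_
      obtain ⟨v, hv, hxv⟩ := hcon x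
      exact ⟨_, ⟨v, hv, rfl⟩, hxv⟩
  choose x hx using hx
  have hmem : ∀ y, ∃ v, y ∈ (e v : Set X) := fun y => by
    obtain ⟨O, hO, hy⟩ := Set.eq_univ_iff_forall.1 hU y
    exact ⟨e.symm ⟨O, hO⟩, by simpa using hy⟩
  have hlt : ∀ w v, x w ∈ (e v : Set X) → w < v := fun w v hwv =>
    lt_of_not_ge fun hvw => hx w v hvw hwv
  refine ⟨Set.range x, ?_, fun y => ?_⟩
  -- Values may repeat, but a value in `e v` is taken only at indices below `v`, so fibres are
  -- small.
  · refine (mk_range_le.trans_eq (mk_ord_toType κ)).eq_of_not_lt fun hr => ?_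
    have hcov : (Set.univ : Set κ.ord.ToType) ⊆ ⋃ y : Set.range x, x ⁻¹' {(y : X)} := fun w _ =>
      Set.mem_iUnion.2 ⟨⟨x w, w, rfl⟩, rfl⟩
    refine ((mk_le_mk_of_subset hcov).trans_lt
      ((card_iUnion_lt_iff_forall_of_isRegular hκ hr).2 fun y => ?_)).ne (by simp)
    obtain ⟨v, hv⟩ := hmem y
    refine (mk_le_mk_of_subset fun w (hw : x w = y) => ?_).trans_lt (hIio v)
    exact hlt w v (hw ▸ hv)
  · obtain ⟨v, hv⟩ := hmem y
    refine ⟨_, (hUo _ (e v).2).mem_nhds hv, ?_⟩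
    have hsub : Set.range x ∩ (e v : Set X) ⊆ x '' Set.Iio v := by
      rintro _ ⟨⟨w, rfl⟩, hw⟩
      exact ⟨w, hlt w v hw, rfl⟩
    exact ((mk_le_mk_of_subset hsub).trans mk_image_le).trans_lt (hIio v)

end NonCompact

/-! ### Classes of points at small distance -/

section SmallIntervals

variable {X : Type u} [LinearOrder X]

/-- Two points are equivalent when the interval between them has fewer than `κ` points of `Y`. -/
def smallIntervalSetoid {κ : Cardinal.{u}} (hκ : ℵ₀ ≤ κ) (Y : Set X)
    (hloc : ∀ x, #(Y ∩ {x} : Set X) < κ) : Setoid X where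
  r x y := #(Y ∩ Set.uIcc x y : Set X) < κ
  iseqv :=
    { refl := fun x => by simpa using hloc x
      symm := fun {x y} h => by rwa [Set.uIcc_comm]
      trans := fun {x y z} h1 h2 => by
        refine ((mk_le_mk_of_subset ?_).trans (mk_union_le _ _)).trans_lt (add_lt_of_lt hκ h1 h2)
        rw [← Set.inter_union_distrib_left]
        exact Set.inter_subset_inter_right _ Set.uIcc_subset_uIcc_union_uIcc }

theorem hasGapOfType_or_of_locally_small [TopologicalSpace X] [OrderTopology X]
    {κ lam : Cardinal.{u}} (hκ : κ.IsRegular) (hlam : lam.IsRegular) (hle : lam ≤ κ)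
    (hmono : ∀ R : Set X, #R = lam → ∃ S ⊆ R, #S = lam ∧
      ((∀ s ∈ S, #{t ∈ S | t ≤ s} < lam) ∨ ∀ s ∈ S, #{t ∈ S | s ≤ t} < lam))
    {Y : Set X} (hY : #Y = κ) (hloc : ∀ x, ∃ N ∈ nhds x, #(Y ∩ N : Set X) < κ) :
    HasGapOfType κ X ∨ HasGapOfType lam X := by
  have hloc' : ∀ x, #(Y ∩ {x} : Set X) < κ := fun x => by
    refine (mk_le_mk_of_subset Set.inter_subset_right).trans_lt ?_
    rw [mk_singleton]
    exact one_lt_aleph0.trans_le hκ.aleph0_le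
  let q : X → Quotient (smallIntervalSetoid hκ.aleph0_le Y hloc') := Quotient.mk _
  have hq : ∀ x y, q x = q y ↔ #(Y ∩ Set.uIcc x y : Set X) < κ := fun x y => Quotient.eq
  by_cases hclass : ∃ c, #{y ∈ Y | q c = q y} = κ
  · left
    obtain ⟨c, hc⟩ := hclass
    have hlocS : ∀ S ⊆ Y, ∀ b : X, ∃ N ∈ nhds b, #(S ∩ N : Set X) < κ := fun S hS b => by
      obtain ⟨N, hN, h⟩ := hloc b
      exact ⟨N, hN, (mk_le_mk_of_subset (Set.inter_subset_inter_left _ hS)).trans_lt h⟩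
    have hseg : ∀ s, q c = q s → ∀ S ⊆ Y ∩ Set.uIcc c s, #S < κ := fun s hs S hS =>
      (mk_le_mk_of_subset hS).trans_lt ((hq c s).1 hs)
    by_cases hup : #{y ∈ Y | q c = q y ∧ c ≤ y} = κ
    · refine hasGapOfType_of_mk_initial_lt hκ hup (fun s hs => hseg s hs.2.1 _ ?_)
        (hlocS _ fun y hy => hy.1)
      exact fun t ht => ⟨ht.1.1, Set.mem_uIcc_of_le ht.1.2.2 ht.2⟩
    · have hdown : #{y ∈ Y | q c = q y ∧ y ≤ c} = κ := by
        refine ((mk_le_mk_of_subset fun y hy => hy.1).trans_eq hY).eq_of_not_lt fun hlt => ?_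
        have hup' := lt_of_le_of_ne ((mk_le_mk_of_subset fun y hy => hy.1).trans_eq hY) hup
        refine (((mk_le_mk_of_subset ?_).trans (mk_union_le _ _)).trans_lt
          (add_lt_of_lt hκ.aleph0_le hup' hlt)).ne hc
        rintro y ⟨hy, hcy⟩
        exact (le_total c y).imp (fun h => ⟨hy, hcy, h⟩) (fun h => ⟨hy, hcy, h⟩)
      refine hasGapOfType_of_mk_final_lt hκ hdown (fun s hs => hseg s hs.2.1 _ ?_)
        (hlocS _ fun y hy => hy.1)
      exact fun t ht => ⟨ht.1.1, Set.mem_uIcc_of_ge ht.2 ht.1.2.2⟩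
  · right
    push Not at hclass
    have hclass' : ∀ c, #{y ∈ Y | q c = q y} < κ := fun c =>
      lt_of_le_of_ne ((mk_le_mk_of_subset fun y hy => hy.1).trans_eq hY) (hclass c)
    have hmany : κ ≤ #(q '' Y) := by
      refine le_of_not_gt fun hlt => ?_
      have hcov : Y ⊆ ⋃ k : q '' Y, {y ∈ Y | (k : Quotient _) = q y} := fun y hy =>
        Set.mem_iUnion.2 ⟨⟨q y, y, hy, rfl⟩, hy, rfl⟩
      refine ((mk_le_mk_of_subset hcov).trans_lt
        ((card_iUnion_lt_iff_forall_of_isRegular hκ hlt).2 ?_)).ne hY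
      rintro ⟨_, c, hc, rfl⟩
      exact hclass' c
    obtain ⟨R, -, hR⟩ := Set.exists_subset_bijOn Y q
    have hRcard : lam ≤ #R := by
      rw [← mk_image_eq_of_injOn q R hR.injOn, hR.image_eq]
      exact hle.trans hmany
    obtain ⟨R', hR'R, hR'⟩ := le_mk_iff_exists_subset.1 hRcard
    obtain ⟨S, hSR, hS, hS'⟩ := hmono R' hR'
    have hlocS : ∀ b : X, ∃ N ∈ nhds b, #(S ∩ N : Set X) < lam := fun b => by
      obtain ⟨N, hN, hNκ⟩ := hloc b
      -- A convex neighbourhood with fewer than `κ` points of `Y` lies in one class, so it meets `S`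
      -- at most once.
      refine ⟨_, Set.ordConnectedComponent_mem_nhds.2 hN, ?_⟩
      have hsub : (S ∩ N.ordConnectedComponent b).Subsingleton := by
        rintro s ⟨hs, hsN⟩ t ⟨ht, htN⟩
        refine hR.injOn (hR'R (hSR hs)) (hR'R (hSR ht)) ((hq s t).2 ?_)
        refine (mk_le_mk_of_subset (Set.inter_subset_inter_right _ ?_)).trans_lt hNκ
        exact (Set.OrdConnected.uIcc_subset inferInstance hsN htN).trans
          Set.ordConnectedComponent_subset
      exact (mk_le_one_iff_set_subsingleton.2 hsub).trans_lt
        (one_lt_aleph0.trans_le hlam.aleph0_le)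
    rcases hS' with h | h
    · exact hasGapOfType_of_mk_initial_lt hlam hS h hlocS
    · exact hasGapOfType_of_mk_final_lt hlam hS h hlocS

end SmallIntervals

theorem mainTheorem3 (𝔥 : Set Cardinal.{u}) (h_nonempty : 𝔥.Nonempty)
    (h_regular : ∀ κ ∈ 𝔥, κ.IsRegular) :
    PropertyP 𝔥 ↔ (sInf 𝔥 = ℵ₀ ∨ IsWeaklyCompact (sInf 𝔥)) := by
  have hmem : sInf 𝔥 ∈ 𝔥 := csInf_mem h_nonempty
  have hmin : ∀ κ ∈ 𝔥, sInf 𝔥 ≤ κ := fun κ hκ => csInf_le' hκ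
  have hreg := h_regular _ hmem
  refine ⟨fun hP => ?_, fun h X _ _ _ => ⟨?_, fun hX κ hκ => ?_⟩⟩
  · rcases hreg.aleph0_le.eq_or_lt with h | h
    · exact Or.inl h.symm
    · exact Or.inr (isWeaklyCompact_of_propertyP hP hmem hmin hreg h)
  · rintro hX ⟨κ, hκ, hgap⟩
    exact hgap.not_isCardinalCompact (h_regular κ hκ).aleph0_le (hX κ hκ)
  · by_contra hcon
    obtain ⟨Y, hY, hloc⟩ := exists_locally_small_of_not_isCardinalCompact (h_regular κ hκ) hcon
    -- The assumption on `sInf 𝔥` enters only here.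
    have hmono : ∀ R : Set X, #R = sInf 𝔥 → ∃ S ⊆ R, #S = sInf 𝔥 ∧
        ((∀ s ∈ S, #{t ∈ S | t ≤ s} < sInf 𝔥) ∨ ∀ s ∈ S, #{t ∈ S | s ≤ t} < sInf 𝔥) := by
      intro R hR
      rcases h with h | h
      · rw [h] at hR ⊢
        exact exists_monotone_subset_aleph0 hR
      · exact exists_monotone_subset_of_isWeaklyCompact h hR
    rcases hasGapOfType_or_of_locally_small (h_regular κ hκ) hreg (hmin κ hκ) hmono hY hloc with
      hg | hg
    · exact hX ⟨κ, hκ, hg⟩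
    · exact hX ⟨_, hmem, hg⟩
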